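/- **Theorem (MOPES guarantee).** *Setting.* Let $\mathcal X'=\{x\in\mathbb R^d:\|x\|\le R\}$ (Euclidean norm), let $f:\mathcal X'\to\mathbb R$ be convex and $G$-Lipschitz with $G>0$ (hence proper and l.s.c.), and let $\mathcal X\subseteq\mathcal X'$ be a convex set with a projection oracle $\mathcal P_{\mathcal X}$, i.e. a map sending every $x\in\mathbb R^d$ to a nearest point of $\mathcal X$. For $x\in\mathcal X'$ let $\partial f(x)=\{g: f(y)\ge f(x)+\langle g,y-x\rangle\ \forall y\in\mathcal X'\}$. Each call $\mathrm{SFO}(u)$ of the stochastic first-order oracle at a (possibly random) query point $u\in\mathcal X'$ returns an integrable random vector $\hat g$ such that, almost surely, $g:=\mathbb E[\hat g\mid u]$ satisfies $g\in\partial f(u)$ and $\|g\|\le G$, and $\mathbb E[\|\hat g-g\|^2\mid u]\le\sigma^2$. *Algorithm MOPES* with inputs $G,\sigma,R,x_0\in\mathcal X',K,\tilde D,\lambda$. Set $x_0'=z_0'=z_0=x_0$. For $k=1,\dots,K$ put $$\beta_k=\frac{4}{\lambda k},\qquad \gamma_k=\frac{2}{k+1},\qquad T_k=\Big\lceil\frac{(4G^2+\sigma^2)\lambda^2Kk^2}{2\tilde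 D}\Big\rceil ,$$ $(y_k,y_k')=(1-\gamma_k)(x_{k-1},x_{k-1}')+\gamma_k(z_{k-1},z_{k-1}')$; $\;z_k=\mathcal P_{\mathcal X}\big(z_{k-1}-\frac1{\beta_k}\cdot\frac{y_k-y_k'}{\lambda}\big)$; $\;(z_k',\tilde z_k')=\text{Prox-Slide}\big(\frac{y_k'-y_k}{\lambda},z_{k-1}',\beta_k,T_k\big)$; $\;(x_k,x_k')=(1-\gamma_k)(x_{k-1},x_{k-1}')+\gamma_k(z_k,\tilde z_k')$. The output is $x_K$. Here $\text{Prox-Slide}(g,u_0,\beta,T)$ sets $\tilde u_0=u_0$ and, for $t=1,\dots,T$, $\theta_t=\frac{2(t+1)}{t(t+3)}$, $\hat g_{t-1}=\mathrm{SFO}(u_{t-1})$, $$\hat u_t=u_{t-1}-\frac{1}{(1+t/2)\beta}\Big(\hat g_{t-1}+\beta\big(u_{t-1}-(u_0-g/\beta)\big)\Big),\qquad u_t=\hat u_t\cdot\min\big(1,R/\|\hat u_t\|\big),\qquad \tilde u_t=(1-\theta_t)\tilde u_{t-1}+\theta_t u_t$$ (with $u_t=0$ if $\hat u_t=0$), and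 returns $(u_T,\tilde u_T)$. *Claim.* For all $c>0$ and $r>0$ there is a constant $C$, depending only on $c$ and $r$, such that the following holds for all $d,R,G,\sigma,f,\mathcal X,\mathcal P_{\mathcal X}$, oracles SFO, $x_0\in\mathcal X'$, $x^*\in\operatorname{argmin}_{x\in\mathcal X}f(x)$ and $\varepsilon>0$. Run MOPES with $$\lambda=\varepsilon/G^2,\qquad \tilde D=c\|x_0-x^*\|^2,\qquad K=\Big\lceil\frac{2\sqrt{10+8c}\;G\|x_0-x^*\|}{\varepsilon}\Big\rceil .$$ Then $x_K\in\mathcal X$ for every realization of the oracle's randomness, $f(x_K)$ is integrable, and $$\mathbb E[f(x_K)]-\min_{x\in\mathcal X}f(x)\le\varepsilon .$$ Moreover, whenever $G\|x_0-x^*\|\ge r\varepsilon$, the run makes at most $C\,\frac{G\|x_0-x^*\|}{\varepsilon}$ calls of the projection oracle and at most $C\,\frac{(G^2+\sigma^2)\|x_0-x^*\|^2}{\varepsilon^2}$ calls of SFO. -/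

import Mathlib

open MeasureTheory

noncomputable section

namespace Mopes

/-- The Euclidean space `ℝ^d`. -/
abbrev Vec (d : ℕ) : Type := EuclideanSpace ℝ (Fin d)

/-- The subdifferential at `x` of `f`, regarded as a function on the set `S` only. -/
def subdiff {d : ℕ} (f : Vec d → ℝ) (S : Set (Vec d)) (x : Vec d) : Set (Vec d) :=
  {g | ∀ y ∈ S, f x + inner ℝ g (y - x) ≤ f y}

/-- `PO` is a projection oracle for `X`: it maps every point of the space to a nearest point
of `X`. -/
def IsProjectionOracle {d : ℕ} (X : Set (Vec d)) (PO : Vec d → Vec d) : Prop :=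
  ∀ x, PO x ∈ X ∧ ∀ y ∈ X, ‖PO x - x‖ ≤ ‖y - x‖

/-- The random vector `ghat` is a valid answer of a stochastic first-order oracle of variance
`σ ^ 2`, for the `G`-Lipschitz convex function `f` on `S`, to the random query point `u`: given `u`,
its conditional mean `g = E[ghat | u]` is a subgradient of `f` at `u` (of norm at most `G`), and
`E[‖ghat - g‖ ^ 2 | u] ≤ σ ^ 2`. -/
structure IsSFOAnswer {d : ℕ} {Ω : Type*} [MeasurableSpace Ω] (P : Measure Ω)
    (f : Vec d → ℝ) (S : Set (Vec d)) (G σ : ℝ) (u ghat : Ω → Vec d) : Prop where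
  measurable_query : Measurable u
  measurable_answer : Measurable ghat
  integrable_answer : Integrable ghat P
  mean_mem : ∀ᵐ ω ∂P, (P[ghat | MeasurableSpace.comap u inferInstance]) ω ∈ subdiff f S (u ω)
  mean_norm_le : ∀ᵐ ω ∂P, ‖(P[ghat | MeasurableSpace.comap u inferInstance]) ω‖ ≤ G
  integrable_sq : Integrable
    (fun ω => ‖ghat ω - (P[ghat | MeasurableSpace.comap u inferInstance]) ω‖ ^ 2) P
  variance_le : ∀ᵐ ω ∂P,
    (P[fun ω' => ‖ghat ω' - (P[ghat | MeasurableSpace.comap u inferInstance]) ω'‖ ^ 2 |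
      MeasurableSpace.comap u inferInstance]) ω ≤ σ ^ 2

/-- The inputs of the method; `lam` is the smoothing parameter, `Dt` the parameter `D̃`,
`K` the number of outer steps and `R` the radius of the ball on which `f` is queried. -/
structure Input (d : ℕ) where
  G : ℝ
  σ : ℝ
  R : ℝ
  lam : ℝ
  Dt : ℝ
  K : ℕ
  x₀ : Vec d

/-- State of the inner loop: current iterate, running average, number of SFO calls made. -/
structure InnerState (d : ℕ) where
  u : Vec d
  avg : Vec d
  foCalls : ℕ

/-- The state after the given number of iterations of the `Prox-Slide` procedure with arguments
`g`, `u₀`, `β`. The `t`-th SFO call (`t = 0, 1, …`) of the procedure with query point `x` is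
answered by `sfo t x`. -/
def proxSlide {d : ℕ} (R : ℝ) (sfo : ℕ → Vec d → Vec d) (g u₀ : Vec d) (β : ℝ) :
    ℕ → InnerState d
  | 0 => { u := u₀, avg := u₀, foCalls := 0 }
  | s + 1 =>
    let prev := proxSlide R sfo g u₀ β s
    -- `t` is the one-based index of the iteration
    let t : ℝ := (s : ℝ) + 1
    let θ : ℝ := 2 * (t + 1) / (t * (t + 3))
    let ghat := sfo s prev.u
    let uhat := prev.u - (1 / ((1 + t / 2) * β)) • (ghat + β • (prev.u - (u₀ - (1 / β) • g)))
    -- projection of `uhat` onto the closed ball of radius `R` around the origin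
    let u := (min 1 (R / ‖uhat‖)) • uhat
    { u := u, avg := (1 - θ) • prev.avg + θ • u, foCalls := prev.foCalls + 1 }

/-- State of the outer loop: the iterates, and the numbers of calls made so far to the projection
oracle and to the stochastic first-order oracle. -/
structure OuterState (d : ℕ) where
  x : Vec d
  x' : Vec d
  z : Vec d
  z' : Vec d
  poCalls : ℕ
  foCalls : ℕ

/-- Step size parameter `β_k`. -/
def Input.beta {d : ℕ} (I : Input d) (k : ℕ) : ℝ := 4 / (I.lam * k)

/-- Averaging weight `γ_k`. -/
def gam (k : ℕ) : ℝ := 2 / ((k : ℝ) + 1)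

/-- Number `T_k` of inner iterations in the outer step `k`. -/
def Input.T {d : ℕ} (I : Input d) (k : ℕ) : ℕ :=
  ⌈(4 * I.G ^ 2 + I.σ ^ 2) * I.lam ^ 2 * I.K * (k : ℝ) ^ 2 / (2 * I.Dt)⌉₊

/-- The point `y_k`, computed from the state `s` reached after `k - 1` outer steps. -/
def midY {d : ℕ} (s : OuterState d) (k : ℕ) : Vec d := (1 - gam k) • s.x + gam k • s.z

/-- The point `y'_k`, computed from the state `s` reached after `k - 1` outer steps. -/
def midY' {d : ℕ} (s : OuterState d) (k : ℕ) : Vec d := (1 - gam k) • s.x' + gam k • s.z'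

/-- The state after `t` inner iterations in the outer step `k`, which starts from `s`. -/
def innerRun {d : ℕ} (I : Input d) (sfo : ℕ → Vec d → Vec d) (s : OuterState d) (k t : ℕ) :
    InnerState d :=
  proxSlide I.R sfo ((1 / I.lam) • (midY' s k - midY s k)) s.z' (I.beta k) t

/-- The outer step `k`, from the state `s`. It makes one call of the projection oracle `PO`. -/
def outerStep {d : ℕ} (I : Input d) (PO : Vec d → Vec d) (sfo : ℕ → Vec d → Vec d)
    (s : OuterState d) (k : ℕ) : OuterState d :=
  let z := PO (s.z - (1 / I.beta k) • ((1 / I.lam) • (midY s k - midY' s k)))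
  let p := innerRun I sfo s k (I.T k)
  { x := (1 - gam k) • s.x + gam k • z
    x' := (1 - gam k) • s.x' + gam k • p.avg
    z := z
    z' := p.u
    poCalls := s.poCalls + 1
    foCalls := s.foCalls + p.foCalls }

/-- The state of MOPES after the given number of outer steps. The SFO call number `t = 0, 1, …` in
the outer step `k = 1, 2, …` with query point `x` is answered by `sfo k t x`. -/
def run {d : ℕ} (I : Input d) (PO : Vec d → Vec d) (sfo : ℕ → ℕ → Vec d → Vec d) :
    ℕ → OuterState d
  | 0 => { x := I.x₀, x' := I.x₀, z := I.x₀, z' := I.x₀, poCalls := 0, foCalls := 0 }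
  | k + 1 => outerStep I PO (sfo (k + 1)) (run I PO sfo k) (k + 1)

/-- The final state of MOPES, after all `K` outer steps. -/
def output {d : ℕ} (I : Input d) (PO : Vec d → Vec d) (sfo : ℕ → ℕ → Vec d → Vec d) :
    OuterState d :=
  run I PO sfo I.K

/-- The point at which MOPES makes its SFO call number `t = 0, 1, …` in the outer step
`k = 1, 2, …`. -/
def query {d : ℕ} (I : Input d) (PO : Vec d → Vec d) (sfo : ℕ → ℕ → Vec d → Vec d) (k t : ℕ) :
    Vec d :=
  (innerRun I (sfo k) (run I PO sfo (k - 1)) k t).u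

/-- The inputs prescribed by the theorem: `λ = ε / G²`, `D̃ = c ‖x₀ - x*‖²` and
`K = ⌈2 √(10 + 8c) G ‖x₀ - x*‖ / ε⌉`. -/
def prescribedInput {d : ℕ} (c G σ R ε : ℝ) (x₀ xs : Vec d) : Input d where
  G := G
  σ := σ
  R := R
  lam := ε / G ^ 2
  Dt := c * ‖x₀ - xs‖ ^ 2
  K := ⌈2 * Real.sqrt (10 + 8 * c) * G * ‖x₀ - xs‖ / ε⌉₊
  x₀ := x₀

end Mopes

end

/-!
The method solves the penalized problem of minimizing `‖x - x'‖ ^ 2 / (2 λ) + f x'` over `x` in the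
feasible set `X` and `x'` in the ball of radius `R`. The two copies of the variable decouple the
projections onto `X` from the subgradients of `f`. As `f` is `G`-Lipschitz, passing from `x'` back
to `x` costs at most `G ^ 2 λ / 2 = ε / 2` (`sub_le_gap_add`), so that it suffices to bring the
objective gap of the penalized problem below `ε / 2`.

The penalty is smooth with constant `2 / λ`, and the outer loop is an accelerated proximal gradient
method for it (`penalty_step`, `outerStep_bound`). The prox step in `x` is one projection. The prox
step in `x'` involves `f` and is solved by a stochastic subgradient method on a strongly convex
function. With the weights `t + 2`, the distances to the comparison point telescope
(`proxSlide_bound`), and, up to a factor `1 + 2 / (T (T + 3))` and to errors from the oracle, the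
inner loop satisfies the inequality of an exact prox step. Since that factor decreases from step to
step, the distances telescope in the outer loop as well (`run_bound`), with the outcome
`K (K + 1) / 2 * gap ≤ 5 ‖x₀ - x*‖ ^ 2 / λ + errors` along every realization.

Only then expectations are taken. The linear part of each error has mean zero, being the inner
product of a conditionally centred vector with a function of the query point (`integral_err_le`),
and the quadratic part is controlled by the variance. The choice of `T_k` makes the expected error
of each outer step at most `4 D̃ / (λ K)` (`integral_innerErr_le`). For the prescribed parameters
the gap is then less than `ε / 2`. The numbers of calls are `K` and the sum of the `T_k`.
-/

namespace Mopes

/-! ### Projections -/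

theorem IsProjectionOracle.inner_nonpos {d : ℕ} {X : Set (Vec d)} {PO : Vec d → Vec d}
    (h : IsProjectionOracle X PO) (hX : Convex ℝ X) (v : Vec d) {y : Vec d} (hy : y ∈ X) :
    inner ℝ (v - PO v) (y - PO v) ≤ 0 := by
  refine (norm_eq_iInf_iff_real_inner_le_zero hX (h v).1).1 ?_ y hy
  have : Nonempty X := ⟨⟨y, hy⟩⟩
  refine le_antisymm (le_ciInf fun w => ?_)
    (ciInf_le ⟨0, by rintro _ ⟨w, rfl⟩; positivity⟩ (⟨PO v, (h v).1⟩ : X))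
  rw [norm_sub_rev v, norm_sub_rev v]
  exact (h v).2 w w.2

theorem IsProjectionOracle.measurable {d : ℕ} {X : Set (Vec d)} {PO : Vec d → Vec d}
    (h : IsProjectionOracle X PO) (hX : Convex ℝ X) : Measurable PO := by
  refine (LipschitzWith.of_dist_le_mul (K := 1) fun x y => ?_).continuous.measurable
  rw [NNReal.coe_one, one_mul, dist_eq_norm, dist_eq_norm]
  have h1 := h.inner_nonpos hX x (h y).1
  have h2 := h.inner_nonpos hX y (h x).1
  have h3 : ‖PO x - PO y‖ ^ 2 ≤ inner ℝ (x - y) (PO x - PO y) := by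
    rw [← real_inner_self_eq_norm_sq]
    simp only [inner_sub_left, inner_sub_right] at *
    linarith [real_inner_comm (PO x) (PO y)]
  have h4 := real_inner_le_norm (x - y) (PO x - PO y)
  by_contra! hlt
  nlinarith [norm_nonneg (PO x - PO y), norm_nonneg (x - y)]

/-- Radial retraction is the metric projection onto a ball around the origin. -/
theorem isProjectionOracle_closedBall {d : ℕ} {R : ℝ} (hR : 0 ≤ R) :
    IsProjectionOracle (Metric.closedBall (0 : Vec d) R) fun v => min 1 (R / ‖v‖) • v := by
  intro v
  rcases le_or_gt ‖v‖ R with hv | hv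
  · have : min 1 (R / ‖v‖) • v = v := by
      rcases eq_or_ne v 0 with rfl | h0
      · simp
      · rw [min_eq_left ((one_le_div (norm_pos_iff.2 h0)).2 hv), one_smul]
    simp [this, hv]
  · have hv0 : 0 < ‖v‖ := hR.trans_lt hv
    dsimp only
    rw [min_eq_right ((div_le_one hv0).2 hv.le)]
    refine ⟨by simp [norm_smul, abs_of_nonneg hR, hv0.ne'], fun y hy => ?_⟩
    rw [mem_closedBall_zero_iff] at hy
    have : (R / ‖v‖) • v - v = (R / ‖v‖ - 1) • v := by module
    rw [this, norm_smul, Real.norm_of_nonpos (by linarith [(div_le_one hv0).2 hv.le])]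
    have h2 : -(R / ‖v‖ - 1) * ‖v‖ = ‖v‖ - R := by field_simp; ring
    rw [h2, norm_sub_rev]
    linarith [norm_sub_norm_le v y]

/-! ### The inner loop -/

/-- The error that one inner iteration contributes, where `δ` is the deviation of the oracle's
answer from a subgradient, and `v` the difference of the query point and the comparison point. -/
noncomputable def err {d : ℕ} (G β : ℝ) (t : ℕ) (δ v : Vec d) : ℝ :=
  (8 * G ^ 2 + 2 * ‖δ‖ ^ 2) / (β * (t + 1)) - inner ℝ δ v

/-- The objective of a prox step that starts from `u₀`. -/
noncomputable def proxObj {d : ℕ} (f : Vec d → ℝ) (g u₀ : Vec d) (β : ℝ) (u : Vec d) : ℝ :=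
  inner ℝ g u + f u + β / 2 * ‖u - u₀‖ ^ 2

/-- The excess of the prox objective after one inner iteration `v ↦ w`. The term
`‖w - v‖ * (2 * G + ‖δ‖)` that measures how far `f` is from its linearization and the answer from
its mean is absorbed by the quadratic `‖w - v‖ ^ 2` of the step. -/
theorem proxObj_step {d : ℕ} {f : Vec d → ℝ} {S : Set (Vec d)} {G β : ℝ} (hβ : 0 < β)
    (hG : 0 ≤ G) (hf : LipschitzOnWith G.toNNReal f S) {g u₀ v w y ghat s : Vec d} {t : ℕ}
    (hv : v ∈ S) (hw : w ∈ S) (hy : y ∈ S) (hs : s ∈ subdiff f S v) (hsG : ‖s‖ ≤ G)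
    (hvar : inner ℝ (v - (1 / ((1 + ((t : ℝ) + 1) / 2) * β)) •
      (ghat + β • (v - (u₀ - (1 / β) • g))) - w) (y - w) ≤ 0) :
    proxObj f g u₀ β w - proxObj f g u₀ β y ≤
      β / 2 * ((t + 1) / 2 * ‖v - y‖ ^ 2 - (1 + (t + 1) / 2) * ‖w - y‖ ^ 2) +
        err G β t (ghat - s) (v - y) := by
  obtain ⟨p, hp⟩ : ∃ p : ℝ, p = ((t : ℝ) + 1) / 2 := ⟨_, rfl⟩
  have hp0 : 0 < p := by rw [hp]; positivity
  rw [← hp] at hvar ⊢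
  -- the variational inequality, multiplied by `(1 + p) * β`
  have hvar' : 0 ≤ inner ℝ ((β * p) • (v - w) - ghat - g - β • (w - u₀)) (w - y) := by
    have h1 : (β * p) • (v - w) - ghat - g - β • (w - u₀) = ((1 + p) * β) •
        (v - (1 / ((1 + p) * β)) • (ghat + β • (v - (u₀ - (1 / β) • g))) - w) := by
      have h2 : (1 + p) * β * (1 / ((1 + p) * β)) = 1 := by field_simp
      have h3 : β * (1 / β) = 1 := by field_simp
      have h4 : ((1 + p) * β) •
          (v - (1 / ((1 + p) * β)) • (ghat + β • (v - (u₀ - (1 / β) • g))) - w) =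
          ((1 + p) * β) • (v - w) - ((1 + p) * β * (1 / ((1 + p) * β))) •
            (ghat + β • (v - u₀) + (β * (1 / β)) • g) := by module
      rw [h4, h2, h3]
      module
    have h4 : w - y = -(y - w) := by module
    rw [h1, inner_smul_left, h4, inner_neg_right]
    have : 0 ≤ (1 + p) * β := by positivity
    simp only [conj_trivial]
    nlinarith
  have hfw : f w - f v ≤ G * ‖w - v‖ := by
    have h := hf.dist_le_mul w hw v hv
    rw [Real.coe_toNNReal _ hG, Real.dist_eq, dist_eq_norm] at h
    exact (le_abs_self _).trans h
  have hsub := hs y hy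
  have hsw : -inner ℝ s (w - v) ≤ G * ‖w - v‖ := by
    have := abs_real_inner_le_norm s (w - v)
    have h2 : ‖s‖ * ‖w - v‖ ≤ G * ‖w - v‖ := by gcongr
    linarith [neg_le_abs (inner ℝ s (w - v))]
  have hdw : -inner ℝ (ghat - s) (w - v) ≤ ‖ghat - s‖ * ‖w - v‖ := by
    have := abs_real_inner_le_norm (ghat - s) (w - v)
    linarith [neg_le_abs (inner ℝ (ghat - s) (w - v))]
  have hyoung : (2 * G + ‖ghat - s‖) * ‖w - v‖ - β * p / 2 * ‖w - v‖ ^ 2 ≤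
      (8 * G ^ 2 + 2 * ‖ghat - s‖ ^ 2) / (β * (t + 1)) := by
    have : (t : ℝ) + 1 = 2 * p := by rw [hp]; ring
    rw [this, le_div_iff₀ (by positivity)]
    nlinarith [sq_nonneg (β * p * ‖w - v‖ - (2 * G + ‖ghat - s‖)),
      sq_nonneg (2 * G - ‖ghat - s‖)]
  have hnw : ‖w - v‖ ^ 2 = ‖v - w‖ ^ 2 := by rw [norm_sub_rev]
  have e1 : ‖y - u₀‖ ^ 2 = ‖w - u₀‖ ^ 2 - 2 * inner ℝ (w - u₀) (w - y) + ‖w - y‖ ^ 2 := by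
    rw [← norm_sub_sq_real]; congr 2; module
  have e2 : ‖v - y‖ ^ 2 = ‖v - w‖ ^ 2 + 2 * inner ℝ (v - w) (w - y) + ‖w - y‖ ^ 2 := by
    rw [← norm_add_sq_real]; congr 2; module
  rw [proxObj, proxObj, err, e1, e2]
  rw [inner_sub_left, inner_sub_left, inner_sub_left, inner_smul_left, inner_smul_left] at hvar'
  have e3 : inner ℝ (ghat - s) (v - y) + inner ℝ (ghat - s) (w - v) =
      inner ℝ ghat (w - y) + inner ℝ s (y - v) - inner ℝ s (w - v) := by
    simp only [inner_sub_left, inner_sub_right]; ring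
  have e4 : inner ℝ g (w - y) = inner ℝ g w - inner ℝ g y := inner_sub_right ..
  simp only [conj_trivial] at hvar'
  rw [hnw] at hyoung
  linarith

theorem proxSlide_foCalls {d : ℕ} (R : ℝ) (sfo : ℕ → Vec d → Vec d) (g u₀ : Vec d) (β : ℝ)
    (T : ℕ) : (proxSlide R sfo g u₀ β T).foCalls = T := by
  induction T with
  | zero => rfl
  | succ T ih => simp only [proxSlide, ih]

theorem averaging_weight_mem {t : ℝ} (ht : 1 ≤ t) :
    0 ≤ 2 * (t + 1) / (t * (t + 3)) ∧ 2 * (t + 1) / (t * (t + 3)) ≤ 1 := by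
  refine ⟨by positivity, (div_le_one (by positivity)).2 (by nlinarith)⟩

theorem proxSlide_mem {d : ℕ} {R : ℝ} (hR : 0 ≤ R) (sfo : ℕ → Vec d → Vec d) (g : Vec d)
    {u₀ : Vec d} (hu₀ : u₀ ∈ Metric.closedBall 0 R) (β : ℝ) (T : ℕ) :
    (proxSlide R sfo g u₀ β T).u ∈ Metric.closedBall 0 R ∧
      (proxSlide R sfo g u₀ β T).avg ∈ Metric.closedBall 0 R := by
  induction T with
  | zero => exact ⟨hu₀, hu₀⟩
  | succ T ih =>
    have hu : (proxSlide R sfo g u₀ β (T + 1)).u ∈ Metric.closedBall 0 R :=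
      (isProjectionOracle_closedBall hR _).1
    have hθ := averaging_weight_mem (t := (T : ℝ) + 1) (by linarith [T.cast_nonneg (α := ℝ)])
    exact ⟨hu, convex_closedBall _ _ ih.2 hu (by linarith [hθ.2]) hθ.1 (by ring)⟩

theorem convexOn_proxObj {d : ℕ} {f : Vec d → ℝ} {S : Set (Vec d)} (hf : ConvexOn ℝ S f)
    (g u₀ : Vec d) {β : ℝ} (hβ : 0 ≤ β) : ConvexOn ℝ S (proxObj f g u₀ β) := by
  refine ⟨hf.1, fun x hx y hy a b ha hb hab => ?_⟩
  have h1 := hf.2 hx hy ha hb hab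
  have h2 : ‖a • x + b • y - u₀‖ ^ 2 ≤ a * ‖x - u₀‖ ^ 2 + b * ‖y - u₀‖ ^ 2 := by
    have h3 : a • x + b • y - u₀ = a • (x - u₀) + b • (y - u₀) := by
      obtain rfl : b = 1 - a := by linarith
      module
    have h4 := (convexOn_pow 2).2 (norm_nonneg (x - u₀)) (norm_nonneg (y - u₀)) ha hb hab
    have h5 : ‖a • x + b • y - u₀‖ ≤ a * ‖x - u₀‖ + b * ‖y - u₀‖ := by
      rw [h3]
      refine (norm_add_le _ _).trans_eq ?_
      rw [norm_smul, norm_smul, Real.norm_of_nonneg ha, Real.norm_of_nonneg hb]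
    simp only [smul_eq_mul] at h4
    exact (pow_le_pow_left₀ (norm_nonneg _) h5 2).trans h4
  simp only [proxObj, inner_add_right, inner_smul_right, smul_eq_mul] at h1 ⊢
  nlinarith [mul_le_mul_of_nonneg_left h2 (half_pos (zero_lt_two' ℝ)).le,
    mul_le_mul_of_nonneg_left h2 (div_nonneg hβ zero_le_two)]

/-- The guarantee of the inner loop along one realization. The weights `t + 2` make the distances
to the comparison point telescope, and the running average is the average with these weights. -/
theorem proxSlide_bound {d : ℕ} {f : Vec d → ℝ} {G R β : ℝ} (hβ : 0 < β) (hG : 0 ≤ G)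
    (hR : 0 ≤ R) (hconv : ConvexOn ℝ (Metric.closedBall 0 R) f)
    (hlip : LipschitzOnWith G.toNNReal f (Metric.closedBall 0 R))
    (sfo : ℕ → Vec d → Vec d) (g : Vec d) {u₀ y : Vec d} (hu₀ : u₀ ∈ Metric.closedBall 0 R)
    (hy : y ∈ Metric.closedBall 0 R) (s : ℕ → Vec d) (T : ℕ)
    (hs : ∀ t < T, s t ∈ subdiff f (Metric.closedBall 0 R) (proxSlide R sfo g u₀ β t).u)
    (hsG : ∀ t < T, ‖s t‖ ≤ G) :
    (T : ℝ) * (T + 3) / 2 *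
        (proxObj f g u₀ β (proxSlide R sfo g u₀ β T).avg - proxObj f g u₀ β y) +
      β / 2 * ((T + 1) * (T + 2) / 2) * ‖(proxSlide R sfo g u₀ β T).u - y‖ ^ 2 ≤
    β / 2 * ‖u₀ - y‖ ^ 2 + ∑ t ∈ Finset.range T, ((t : ℝ) + 2) *
      err G β t (sfo t (proxSlide R sfo g u₀ β t).u - s t) ((proxSlide R sfo g u₀ β t).u - y) := by
  induction T with
  | zero => simp [proxSlide]
  | succ T ih =>
    have ih := ih (fun t ht => hs t (by lia)) (fun t ht => hsG t (by lia))
    have hm := proxSlide_mem hR sfo g hu₀ β T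
    have hm' := proxSlide_mem hR sfo g hu₀ β (T + 1)
    have hstep := proxObj_step hβ hG hlip (g := g) (u₀ := u₀)
      (ghat := sfo T (proxSlide R sfo g u₀ β T).u) (t := T) hm.1 hm'.1 hy (hs T (by lia))
      (hsG T (by lia))
      ((isProjectionOracle_closedBall hR).inner_nonpos (convex_closedBall _ _) _ hy)
    rw [Finset.sum_range_succ]
    have hθ := averaging_weight_mem (t := (T : ℝ) + 1) (by linarith [T.cast_nonneg (α := ℝ)])
    have havg := (convexOn_proxObj hconv g u₀ hβ.le).2 hm.2 hm'.1
      (sub_nonneg.2 hθ.2) hθ.1 (by ring)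
    change proxObj f g u₀ β (proxSlide R sfo g u₀ β (T + 1)).avg ≤ _ at havg
    simp only [smul_eq_mul] at havg
    -- the sum of the weights times the averaging weight is the weight of the new iterate
    have hW : ((T : ℝ) + 1) * (T + 1 + 3) / 2 *
        (2 * ((T : ℝ) + 1 + 1) / ((T + 1) * (T + 1 + 3))) = T + 2 := by
      field_simp; ring
    have h1 := mul_le_mul_of_nonneg_left havg
      (show (0 : ℝ) ≤ ((T : ℝ) + 1) * (T + 1 + 3) / 2 by positivity)
    have h2 := mul_le_mul_of_nonneg_left hstep (show (0 : ℝ) ≤ (T : ℝ) + 2 by positivity)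
    generalize 2 * ((T : ℝ) + 1 + 1) / ((T + 1) * (T + 1 + 3)) = θ at h1 hW
    have h3 (a b : ℝ) : ((T : ℝ) + 1) * (T + 1 + 3) / 2 * ((1 - θ) * a + θ * b) =
        (((T : ℝ) + 1) * (T + 1 + 3) / 2 - (T + 2)) * a + (T + 2) * b := by
      linear_combination (b - a) * hW
    rw [h3] at h1
    push_cast
    linarith

/-! ### The outer loop -/

/-- The objective gap of the penalized problem: the excess over `f xs` of `f x'` plus the quadratic
penalty on the distance of the two copies `x` and `x'` of the variable. -/
noncomputable def gap {d : ℕ} (f : Vec d → ℝ) (xs : Vec d) (lam : ℝ) (x x' : Vec d) : ℝ :=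
  ‖x - x'‖ ^ 2 / (2 * lam) + f x' - f xs

/-- The slack `2 / (T (T + 3))` with which the inner loop solves the prox step. -/
noncomputable def slack (T : ℕ) : ℝ := 2 / ((T : ℝ) * (T + 3))

/-- The weighted error that the inner loop contributes, for the answers `sfo`, the subgradients `s`
and the comparison point `y`. -/
noncomputable def innerErr {d : ℕ} (I : Input d) (sfo : ℕ → Vec d → Vec d) (s : ℕ → Vec d)
    (st : OuterState d) (k : ℕ) (y : Vec d) : ℝ :=
  slack (I.T k) * ∑ t ∈ Finset.range (I.T k), ((t : ℝ) + 2) *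
    err I.G (I.beta k) t (sfo t (innerRun I sfo st k t).u - s t) ((innerRun I sfo st k t).u - y)

theorem slack_nonneg (T : ℕ) : 0 ≤ slack T := by unfold slack; positivity

theorem slack_anti {m n : ℕ} (hm : 0 < m) (h : m ≤ n) : slack n ≤ slack m := by
  have : (0 : ℝ) < m := by exact_mod_cast hm
  have h' : (m : ℝ) ≤ n := by exact_mod_cast h
  unfold slack; gcongr

theorem slack_le_half {m : ℕ} (hm : 0 < m) : slack m ≤ 1 / 2 := by
  have := slack_anti one_pos hm
  norm_num [slack] at this ⊢
  exact this

/-- The guarantee of the inner loop after division by the sum `T (T + 3) / 2` of its weights: the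
last iterate behaves like the exact solution of the prox step, up to the factor `1 + slack T`. -/
theorem proxSlide_bound_div {d : ℕ} {I : Input d} {f : Vec d → ℝ} {k : ℕ} (hβ : 0 < I.beta k)
    (hG : 0 ≤ I.G) (hR : 0 ≤ I.R) (hconv : ConvexOn ℝ (Metric.closedBall 0 I.R) f)
    (hlip : LipschitzOnWith I.G.toNNReal f (Metric.closedBall 0 I.R)) (hT : 0 < I.T k)
    (sfo : ℕ → Vec d → Vec d) {st : OuterState d} {y : Vec d}
    (hu₀ : st.z' ∈ Metric.closedBall 0 I.R)
    (hy : y ∈ Metric.closedBall 0 I.R) (s : ℕ → Vec d)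
    (hs : ∀ t < I.T k, s t ∈ subdiff f (Metric.closedBall 0 I.R) (innerRun I sfo st k t).u)
    (hsG : ∀ t < I.T k, ‖s t‖ ≤ I.G) :
    1 / I.lam * inner ℝ (midY' st k - midY st k) ((innerRun I sfo st k (I.T k)).avg - y) +
        f (innerRun I sfo st k (I.T k)).avg - f y +
        I.beta k / 2 * ‖(innerRun I sfo st k (I.T k)).avg - st.z'‖ ^ 2 ≤
      I.beta k / 2 * (1 + slack (I.T k)) *
        (‖st.z' - y‖ ^ 2 - ‖(innerRun I sfo st k (I.T k)).u - y‖ ^ 2) +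
      innerErr I sfo s st k y := by
  have h := proxSlide_bound hβ hG hR hconv hlip sfo ((1 / I.lam) • (midY' st k - midY st k)) hu₀ hy
    s (I.T k) hs hsG
  have hT' : (0 : ℝ) < I.T k := by exact_mod_cast hT
  have h := mul_le_mul_of_nonneg_left h (slack_nonneg (I.T k))
  have h1 : slack (I.T k) * ((I.T k : ℝ) * (I.T k + 3) / 2) = 1 := by
    unfold slack; field_simp
  have h2 : slack (I.T k) * (((I.T k : ℝ) + 1) * (I.T k + 2) / 2) = 1 + slack (I.T k) := by
    linear_combination h1
  rw [mul_add (slack (I.T k)) (_ * _), mul_add (slack (I.T k)) (_ * _), ← mul_assoc, h1,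
    show ∀ a b c e : ℝ, a * (b * c * e) = b * (a * c) * e by intros; ring, h2] at h
  unfold innerErr innerRun
  simp only [proxObj, inner_smul_left, conj_trivial] at h
  rw [inner_sub_right, norm_sub_rev st.z' y]
  rw [norm_sub_rev st.z' y] at h
  linarith

/-- Smoothness and convexity of the quadratic penalty: here `a`, `b`, `n` are the differences of
the two copies of the variable at the old average, the old prox centre and the new prox centre. -/
theorem penalty_step {E : Type*} [NormedAddCommGroup E] [InnerProductSpace ℝ E] {γ : ℝ}
    (hγ : 0 ≤ γ) (hγ1 : γ ≤ 1) (a b n : E) :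
    ‖(1 - γ) • a + γ • n‖ ^ 2 ≤ (1 - γ) * ‖a‖ ^ 2 +
      2 * γ * inner ℝ ((1 - γ) • a + γ • b) n + γ ^ 2 * ‖n - b‖ ^ 2 := by
  obtain ⟨q, hq⟩ : ∃ q, q = (1 - γ) • a + γ • b := ⟨_, rfl⟩
  have h1 : (1 - γ) • a + γ • n = q + γ • (n - b) := by rw [hq]; module
  have h2 : ‖q + γ • (n - b)‖ ^ 2 =
      ‖q‖ ^ 2 + 2 * γ * inner ℝ q (n - b) + γ ^ 2 * ‖n - b‖ ^ 2 := by
    rw [norm_add_sq_real, inner_smul_right, norm_smul, mul_pow, Real.norm_of_nonneg hγ]; ring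
  have h3 : 0 ≤ ‖a‖ ^ 2 - 2 * inner ℝ q a + ‖q‖ ^ 2 := by
    rw [real_inner_comm, ← norm_sub_sq_real]; positivity
  have h4 : ‖q‖ ^ 2 = (1 - γ) * inner ℝ q a + γ * inner ℝ q b := by
    rw [← real_inner_self_eq_norm_sq]
    nth_rewrite 2 [hq]
    rw [inner_add_right, inner_smul_right, inner_smul_right]
  rw [← hq, h1, h2, inner_sub_right]
  nlinarith [mul_nonneg (sub_nonneg.2 hγ1) h3, mul_nonneg hγ (sq_nonneg ‖q‖)]

theorem gam_mem {k : ℕ} (hk : 1 ≤ k) : 0 ≤ gam k ∧ gam k ≤ 1 := by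
  have : (1 : ℝ) ≤ k := by exact_mod_cast hk
  exact ⟨by unfold gam; positivity, (div_le_one (by positivity)).2 (by linarith)⟩

/-- One step of the accelerated method for the penalized problem. The projection step solves the
prox step in the variable `x` exactly, the inner loop the one in `x'` approximately; the quadratic
terms `‖zn - z‖ ^ 2`, `‖zt - z'‖ ^ 2` of both absorb the smoothness term of the penalty, since
`γ_k ^ 2 / lam ≤ γ_k * β_k / 2`. -/
theorem outerStep_bound {d : ℕ} {I : Input d} {f : Vec d → ℝ} {X : Set (Vec d)}
    {PO : Vec d → Vec d} {k : ℕ} (hk : 1 ≤ k) (hlam : 0 < I.lam)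
    (hG : 0 ≤ I.G) (hR : 0 ≤ I.R) (hconv : ConvexOn ℝ (Metric.closedBall 0 I.R) f)
    (hlip : LipschitzOnWith I.G.toNNReal f (Metric.closedBall 0 I.R)) (hT : 0 < I.T k)
    (hX : Convex ℝ X) (hPO : IsProjectionOracle X PO)
    (sfo : ℕ → Vec d → Vec d) {st : OuterState d} {y : Vec d}
    (hx' : st.x' ∈ Metric.closedBall 0 I.R) (hu₀ : st.z' ∈ Metric.closedBall 0 I.R)
    (hyX : y ∈ X) (hy : y ∈ Metric.closedBall 0 I.R) (s : ℕ → Vec d)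
    (hs : ∀ t < I.T k, s t ∈ subdiff f (Metric.closedBall 0 I.R) (innerRun I sfo st k t).u)
    (hsG : ∀ t < I.T k, ‖s t‖ ≤ I.G) :
    (k : ℝ) * (k + 1) / 2 *
        gap f y I.lam (outerStep I PO sfo st k).x (outerStep I PO sfo st k).x' +
      2 / I.lam * ‖(outerStep I PO sfo st k).z - y‖ ^ 2 +
      2 / I.lam * (1 + slack (I.T k)) * ‖(outerStep I PO sfo st k).z' - y‖ ^ 2 ≤
    (k : ℝ) * (k - 1) / 2 * gap f y I.lam st.x st.x' + 2 / I.lam * ‖st.z - y‖ ^ 2 +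
      2 / I.lam * (1 + slack (I.T k)) * ‖st.z' - y‖ ^ 2 + k * innerErr I sfo s st k y := by
  have hk0 : (0 : ℝ) < k := by exact_mod_cast hk
  have hβ : 0 < I.beta k := by unfold Input.beta; positivity
  have hprox := proxSlide_bound_div hβ hG hR hconv hlip hT sfo hu₀ hy s hs hsG
  have hmem := proxSlide_mem hR sfo ((1 / I.lam) • (midY' st k - midY st k)) hu₀ (I.beta k) (I.T k)
  have hproj := hPO.inner_nonpos hX
    (st.z - (1 / I.beta k) • ((1 / I.lam) • (midY st k - midY' st k))) hyX
  have hγ := gam_mem hk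
  have hf := hconv.2 hx' hmem.2 (sub_nonneg.2 hγ.2) hγ.1 (by ring)
  obtain ⟨zn, hzn⟩ : ∃ zn, zn = (outerStep I PO sfo st k).z := ⟨_, rfl⟩
  obtain ⟨zt, hzt⟩ : ∃ zt, zt = (innerRun I sfo st k (I.T k)).avg := ⟨_, rfl⟩
  obtain ⟨zn', hzn'⟩ : ∃ zn', zn' = (outerStep I PO sfo st k).z' := ⟨_, rfl⟩
  have hx : (outerStep I PO sfo st k).x = (1 - gam k) • st.x + gam k • zn := by rw [hzn]; rfl
  have hxn' : (outerStep I PO sfo st k).x' = (1 - gam k) • st.x' + gam k • zt := by rw [hzt]; rfl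
  change inner ℝ (_ - (outerStep I PO sfo st k).z) (y - (outerStep I PO sfo st k).z) ≤ 0 at hproj
  change f ((1 - gam k) • st.x' + gam k • (innerRun I sfo st k (I.T k)).avg) ≤
    (1 - gam k) • f st.x' + gam k • f (innerRun I sfo st k (I.T k)).avg at hf
  rw [show (innerRun I sfo st k (I.T k)).u = zn' from hzn'.symm] at hprox
  rw [← hzt] at hprox hf
  rw [← hzn] at hproj ⊢
  rw [← hzn', hx, hxn']
  generalize slack (I.T k) = τ at hprox ⊢
  generalize innerErr I sfo s st k y = ie at hprox ⊢
  have hpen := penalty_step hγ.1 hγ.2 (st.x - st.x') (st.z - st.z') (zn - zt)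
  have hq : midY st k - midY' st k =
      (1 - gam k) • (st.x - st.x') + gam k • (st.z - st.z') := by
    unfold midY midY'; module
  obtain ⟨q, hq'⟩ : ∃ q, q = midY st k - midY' st k := ⟨_, rfl⟩
  have hq'' : midY' st k - midY st k = -q := by rw [hq']; module
  rw [← hq, ← hq'] at hpen
  rw [← hq'] at hproj
  rw [hq'', inner_neg_left] at hprox
  have hdiff : (1 - gam k) • st.x + gam k • zn - ((1 - gam k) • st.x' + gam k • zt) =
      (1 - gam k) • (st.x - st.x') + gam k • (zn - zt) := by module
  have hsplit : ‖zn - zt - (st.z - st.z')‖ ^ 2 ≤ 2 * ‖zn - st.z‖ ^ 2 + 2 * ‖zt - st.z'‖ ^ 2 := by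
    have h1 : zn - zt - (st.z - st.z') = (zn - st.z) - (zt - st.z') := by module
    have h2 := parallelogram_law_with_norm ℝ (zn - st.z) (zt - st.z')
    rw [h1]
    nlinarith [mul_self_nonneg ‖zn - st.z + (zt - st.z')‖]
  have hproj' : 1 / I.lam * inner ℝ q (zn - y) ≤
      I.beta k / 2 * (‖st.z - y‖ ^ 2 - ‖zn - y‖ ^ 2 - ‖zn - st.z‖ ^ 2) := by
    have h1 : st.z - (1 / I.beta k) • ((1 / I.lam) • q) - zn =
        (1 / I.beta k) • (I.beta k • (st.z - zn) - (1 / I.lam) • q) := by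
      have h : 1 / I.beta k * I.beta k = 1 := one_div_mul_cancel hβ.ne'
      rw [smul_sub _ (I.beta k • _), smul_smul _ (I.beta k), h, one_smul]; module
    have h2 : y - zn = -(zn - y) := by module
    rw [h1, h2, inner_neg_right, inner_smul_left, inner_sub_left, inner_smul_left,
      inner_smul_left] at hproj
    simp only [conj_trivial] at hproj
    have h3 : ‖st.z - y‖ ^ 2 =
        ‖zn - st.z‖ ^ 2 + 2 * inner ℝ (st.z - zn) (zn - y) + ‖zn - y‖ ^ 2 := by
      rw [norm_sub_rev zn, ← norm_add_sq_real]; congr 2; module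
    have h4 : 0 < 1 / I.beta k := by positivity
    have h5 := (mul_nonneg_iff_of_pos_left h4).1 (neg_nonpos.1 hproj)
    rw [h3]
    linarith
  have hinner : inner ℝ q (zn - zt) = inner ℝ q (zn - y) - inner ℝ q (zt - y) := by
    simp only [inner_sub_right]; ring
  have hkγ : (k : ℝ) * (k + 1) / 2 * gam k = k := by unfold gam; field_simp
  have hkγ1 : (k : ℝ) * (k + 1) / 2 * (1 - gam k) = k * (k - 1) / 2 := by
    linear_combination -hkγ
  have hkβ : (k : ℝ) * I.beta k = 4 / I.lam := by unfold Input.beta; field_simp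
  have hkγ2 : (k : ℝ) * (gam k / I.lam) ≤ 2 / I.lam := by
    unfold gam
    rw [mul_div_assoc', div_le_div_iff_of_pos_right hlam, mul_div_assoc',
      div_le_iff₀ (by positivity)]
    linarith
  -- the smoothness inequality of the penalty, with the weight `k (k + 1) / 2 = k / γ_k`
  have hpen' : (k : ℝ) * (k + 1) / 2 *
      (‖(1 - gam k) • (st.x - st.x') + gam k • (zn - zt)‖ ^ 2 / (2 * I.lam)) ≤
      k * (k - 1) / 2 * (‖st.x - st.x'‖ ^ 2 / (2 * I.lam)) +
        k * (1 / I.lam * (inner ℝ q (zn - y) - inner ℝ q (zt - y))) +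
        2 / I.lam * (‖zn - st.z‖ ^ 2 + ‖zt - st.z'‖ ^ 2) := by
    have hm : (0 : ℝ) ≤ k * (k + 1) / 2 / (2 * I.lam) := by positivity
    have h1 := mul_le_mul_of_nonneg_left hpen hm
    have h2 := mul_le_mul_of_nonneg_left hsplit
      (show (0 : ℝ) ≤ (k : ℝ) * (gam k / (2 * I.lam)) by have := hγ.1; positivity)
    have h3 := mul_le_mul_of_nonneg_right hkγ2
      (show (0 : ℝ) ≤ ‖zn - st.z‖ ^ 2 + ‖zt - st.z'‖ ^ 2 by positivity)
    rw [hinner] at h1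
    have e1 : (k : ℝ) * (k + 1) / 2 / (2 * I.lam) * ((1 - gam k) * ‖st.x - st.x'‖ ^ 2 +
        2 * gam k * (inner ℝ q (zn - y) - inner ℝ q (zt - y)) +
        gam k ^ 2 * ‖zn - zt - (st.z - st.z')‖ ^ 2) =
        k * (k - 1) / 2 * (‖st.x - st.x'‖ ^ 2 / (2 * I.lam)) +
        k * (1 / I.lam * (inner ℝ q (zn - y) - inner ℝ q (zt - y))) +
        k * (gam k / (2 * I.lam)) * ‖zn - zt - (st.z - st.z')‖ ^ 2 := by
      rw [← hkγ1]
      have : (k : ℝ) * (k + 1) / 2 * gam k * (1 / I.lam) = k * (1 / I.lam) := by rw [hkγ]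
      have h5 : (k : ℝ) * (k + 1) / 2 * gam k * (gam k / (2 * I.lam)) =
        k * (gam k / (2 * I.lam)) := by rw [hkγ]
      linear_combination (inner ℝ q (zn - y) - inner ℝ q (zt - y)) * this +
        ‖zn - zt - (st.z - st.z')‖ ^ 2 * h5
    rw [e1] at h1
    have e2 : (k : ℝ) * (gam k / (2 * I.lam)) *
        (2 * ‖zn - st.z‖ ^ 2 + 2 * ‖zt - st.z'‖ ^ 2) =
        k * (gam k / I.lam) * (‖zn - st.z‖ ^ 2 + ‖zt - st.z'‖ ^ 2) := by
      field_simp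
    calc _ = (k : ℝ) * (k + 1) / 2 / (2 * I.lam) *
          ‖(1 - gam k) • (st.x - st.x') + gam k • (zn - zt)‖ ^ 2 := by ring
      _ ≤ _ := by linarith
  have hf' := mul_le_mul_of_nonneg_left hf (show (0 : ℝ) ≤ (k : ℝ) * (k + 1) / 2 by positivity)
  have hprox' := mul_le_mul_of_nonneg_left hprox hk0.le
  have hproj'' := mul_le_mul_of_nonneg_left hproj' hk0.le
  simp only [smul_eq_mul] at hf'
  have e3 : (k : ℝ) * (k + 1) / 2 * ((1 - gam k) * f st.x' + gam k * f zt) =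
      k * (k - 1) / 2 * f st.x' + k * f zt := by
    linear_combination f st.x' * hkγ1 + f zt * hkγ
  have e4 (a : ℝ) : (k : ℝ) * (I.beta k / 2 * a) = 2 / I.lam * a := by
    linear_combination a / 2 * hkβ
  rw [e3] at hf'
  rw [e4] at hproj''
  rw [mul_add (k : ℝ) _ ie, mul_assoc (I.beta k / 2), e4, mul_add (k : ℝ) _ (I.beta k / 2 * _),
    e4] at hprox'
  unfold gap
  rw [hdiff]
  linarith

theorem run_poCalls {d : ℕ} (I : Input d) (PO : Vec d → Vec d) (sfo : ℕ → ℕ → Vec d → Vec d)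
    (k : ℕ) : (run I PO sfo k).poCalls = k := by
  induction k with
  | zero => rfl
  | succ k ih => simp only [run, outerStep, ih]

theorem run_foCalls {d : ℕ} (I : Input d) (PO : Vec d → Vec d) (sfo : ℕ → ℕ → Vec d → Vec d)
    (k : ℕ) : (run I PO sfo k).foCalls = ∑ j ∈ Finset.range k, I.T (j + 1) := by
  induction k with
  | zero => rfl
  | succ k ih =>
    rw [Finset.sum_range_succ, ← ih]
    simp only [run, outerStep, innerRun, proxSlide_foCalls]

theorem run_mem_ball {d : ℕ} {I : Input d} (hR : 0 ≤ I.R) (hx₀ : I.x₀ ∈ Metric.closedBall 0 I.R)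
    (PO : Vec d → Vec d) (sfo : ℕ → ℕ → Vec d → Vec d) (k : ℕ) :
    (run I PO sfo k).x' ∈ Metric.closedBall 0 I.R ∧
      (run I PO sfo k).z' ∈ Metric.closedBall 0 I.R := by
  induction k with
  | zero => exact ⟨hx₀, hx₀⟩
  | succ k ih =>
    have hγ := gam_mem (show 1 ≤ k + 1 by lia)
    have h := proxSlide_mem hR (sfo (k + 1)) ((1 / I.lam) •
      (midY' (run I PO sfo k) (k + 1) - midY (run I PO sfo k) (k + 1))) ih.2 (I.beta (k + 1))
      (I.T (k + 1))
    exact ⟨convex_closedBall _ _ ih.1 h.2 (sub_nonneg.2 hγ.2) hγ.1 (by ring), h.1⟩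

/-- Since `γ₁ = 1`, the first step discards `x₀`, which need not be feasible. -/
theorem run_x_mem {d : ℕ} {I : Input d} {X : Set (Vec d)} {PO : Vec d → Vec d}
    (hX : Convex ℝ X) (hPO : IsProjectionOracle X PO) (sfo : ℕ → ℕ → Vec d → Vec d) (k : ℕ) :
    (run I PO sfo (k + 1)).x ∈ X := by
  induction k with
  | zero =>
    have h1 : gam (0 + 1) = 1 := by norm_num [gam]
    simp only [run, outerStep, h1, sub_self, zero_smul, one_smul, zero_add]
    exact (hPO _).1
  | succ k ih =>
    have hγ := gam_mem (show 1 ≤ k + 1 + 1 by lia)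
    exact hX ih (hPO _).1 (sub_nonneg.2 hγ.2) hγ.1 (by ring)

theorem Input.T_pos {d : ℕ} {I : Input d} (hlam : 0 < I.lam) (hG : 0 < I.G) (hDt : 0 < I.Dt)
    (hK : 0 < I.K) {k : ℕ} (hk : 1 ≤ k) : 0 < I.T k := by
  have : (0 : ℝ) < k := by exact_mod_cast hk
  have : (0 : ℝ) < I.K := by exact_mod_cast hK
  unfold Input.T
  rw [Nat.ceil_pos]
  positivity

theorem Input.T_mono {d : ℕ} (I : Input d) (hDt : 0 < I.Dt) : Monotone I.T := by
  intro m n h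
  have : (m : ℝ) ≤ n := by exact_mod_cast h
  unfold Input.T
  gcongr

/-- The guarantee of the outer loop along one realization. The potential on the left contracts
because the inner slacks decrease. -/
theorem run_bound {d : ℕ} {I : Input d} {f : Vec d → ℝ} {X : Set (Vec d)}
    {PO : Vec d → Vec d} (hlam : 0 < I.lam) (hG : 0 < I.G) (hR : 0 ≤ I.R) (hDt : 0 < I.Dt)
    (hK : 0 < I.K) (hconv : ConvexOn ℝ (Metric.closedBall 0 I.R) f)
    (hlip : LipschitzOnWith I.G.toNNReal f (Metric.closedBall 0 I.R))
    (hX : Convex ℝ X) (hPO : IsProjectionOracle X PO)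
    (hx₀ : I.x₀ ∈ Metric.closedBall 0 I.R) (sfo : ℕ → ℕ → Vec d → Vec d) {y : Vec d}
    (hyX : y ∈ X) (hy : y ∈ Metric.closedBall 0 I.R) (s : ℕ → ℕ → Vec d) (k : ℕ)
    (hs : ∀ j t, 1 ≤ j → j ≤ k → t < I.T j →
      s j t ∈ subdiff f (Metric.closedBall 0 I.R) (query I PO sfo j t))
    (hsG : ∀ j t, 1 ≤ j → j ≤ k → t < I.T j → ‖s j t‖ ≤ I.G) :
    (k : ℝ) * (k + 1) / 2 * gap f y I.lam (run I PO sfo k).x (run I PO sfo k).x' +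
      2 / I.lam * ‖(run I PO sfo k).z - y‖ ^ 2 +
      2 / I.lam * (1 + slack (I.T (k + 1))) * ‖(run I PO sfo k).z' - y‖ ^ 2 ≤
    5 / I.lam * ‖I.x₀ - y‖ ^ 2 + ∑ j ∈ Finset.range k, ((j : ℝ) + 1) *
      innerErr I (sfo (j + 1)) (s (j + 1)) (run I PO sfo j) (j + 1) y := by
  induction k with
  | zero =>
    have h1 := slack_le_half (I.T_pos hlam hG hDt hK (show 1 ≤ 0 + 1 by lia))
    have h2 : 2 / I.lam * (1 + slack (I.T (0 + 1))) * ‖I.x₀ - y‖ ^ 2 ≤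
        2 / I.lam * (1 + 1 / 2) * ‖I.x₀ - y‖ ^ 2 := by gcongr
    have h3 : 2 / I.lam * (1 + 1 / 2) * ‖I.x₀ - y‖ ^ 2 =
        5 / I.lam * ‖I.x₀ - y‖ ^ 2 - 2 / I.lam * ‖I.x₀ - y‖ ^ 2 := by ring
    simp only [run, Finset.range_zero, Finset.sum_empty]
    push_cast
    linarith
  | succ k ih =>
    have ih := ih (fun j t h1 h2 h3 => hs j t h1 (by lia) h3)
      (fun j t h1 h2 h3 => hsG j t h1 (by lia) h3)
    have hmem := run_mem_ball hR hx₀ PO sfo k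
    have hstep := outerStep_bound (show 1 ≤ k + 1 by lia) hlam hG.le hR hconv hlip
      (I.T_pos hlam hG hDt hK (by lia)) hX hPO (sfo (k + 1)) hmem.1 hmem.2 hyX hy (s (k + 1))
      (fun t ht => hs (k + 1) t (by lia) le_rfl ht) (fun t ht => hsG (k + 1) t (by lia) le_rfl ht)
    have hanti := slack_anti (I.T_pos hlam hG hDt hK (show 1 ≤ k + 1 by lia))
      (I.T_mono hDt (show k + 1 ≤ k + 1 + 1 by lia))
    have h2 : 2 / I.lam * (1 + slack (I.T (k + 1 + 1))) * ‖(run I PO sfo (k + 1)).z' - y‖ ^ 2 ≤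
        2 / I.lam * (1 + slack (I.T (k + 1))) * ‖(run I PO sfo (k + 1)).z' - y‖ ^ 2 := by gcongr
    rw [Finset.sum_range_succ]
    have hrun : outerStep I PO (sfo (k + 1)) (run I PO sfo k) (k + 1) = run I PO sfo (k + 1) := rfl
    rw [hrun] at hstep
    push_cast at hstep ⊢
    linarith

/-- The quadratic penalty pays for passing from `x'` to `x`, up to `G ^ 2 * lam / 2`. -/
theorem sub_le_gap_add {d : ℕ} {f : Vec d → ℝ} {S : Set (Vec d)} {G lam : ℝ} (hG : 0 ≤ G)
    (hlam : 0 < lam) (hlip : LipschitzOnWith G.toNNReal f S) {x x' : Vec d} (hx : x ∈ S)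
    (hx' : x' ∈ S) (y : Vec d) : f x - f y ≤ gap f y lam x x' + G ^ 2 * lam / 2 := by
  have h := hlip.dist_le_mul x hx x' hx'
  rw [Real.coe_toNNReal _ hG, Real.dist_eq, dist_eq_norm] at h
  have h1 := (le_abs_self _).trans h
  have h2 : G * ‖x - x'‖ ≤ ‖x - x'‖ ^ 2 / (2 * lam) + G ^ 2 * lam / 2 := by
    rw [← sub_le_iff_le_add, le_div_iff₀ (by positivity)]
    nlinarith [sq_nonneg (‖x - x'‖ - G * lam)]
  unfold gap
  linarith

/-! ### Expectations -/

theorem measurable_proxSlide {d : ℕ} {Ω : Type*} [MeasurableSpace Ω] {R β : ℝ}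
    {sfo : Ω → ℕ → Vec d → Vec d} {g u₀ : Ω → Vec d} (hg : Measurable g) (hu₀ : Measurable u₀)
    (T : ℕ)
    (h : ∀ t < T, Measurable fun ω => sfo ω t (proxSlide R (sfo ω) (g ω) (u₀ ω) β t).u) :
    Measurable (fun ω => (proxSlide R (sfo ω) (g ω) (u₀ ω) β T).u) ∧
      Measurable (fun ω => (proxSlide R (sfo ω) (g ω) (u₀ ω) β T).avg) := by
  induction T with
  | zero => exact ⟨hu₀, hu₀⟩
  | succ T ih =>
    have ih := ih fun t ht => h t (by lia)
    have hT := h T (by lia)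
    have hu : Measurable (fun ω => (proxSlide R (sfo ω) (g ω) (u₀ ω) β (T + 1)).u) := by
      have h1 := ih.1
      have huhat : Measurable fun ω => (proxSlide R (sfo ω) (g ω) (u₀ ω) β T).u -
          (1 / ((1 + ((T : ℝ) + 1) / 2) * β)) •
            (sfo ω T (proxSlide R (sfo ω) (g ω) (u₀ ω) β T).u +
              β • ((proxSlide R (sfo ω) (g ω) (u₀ ω) β T).u - (u₀ ω - (1 / β) • g ω))) :=
        h1.sub ((hT.add ((h1.sub (hu₀.sub (hg.const_smul (1 / β)))).const_smul β)).const_smul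
          (1 / ((1 + ((T : ℝ) + 1) / 2) * β)))
      exact (measurable_const.min (measurable_const.div huhat.norm)).smul huhat
    refine ⟨hu, ?_⟩
    have h2 := ih.2
    simp only [proxSlide] at hu ⊢
    fun_prop

theorem measurable_run {d : ℕ} {Ω : Type*} [MeasurableSpace Ω] {I : Input d}
    {PO : Vec d → Vec d} (hPO : Measurable PO) {sfo : Ω → ℕ → ℕ → Vec d → Vec d} (k : ℕ)
    (h : ∀ j t, 1 ≤ j → j ≤ k → t < I.T j →
      Measurable fun ω => sfo ω j t (query I PO (sfo ω) j t)) :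
    Measurable (fun ω => (run I PO (sfo ω) k).x) ∧ Measurable (fun ω => (run I PO (sfo ω) k).x') ∧
      Measurable (fun ω => (run I PO (sfo ω) k).z) ∧
      Measurable (fun ω => (run I PO (sfo ω) k).z') := by
  induction k with
  | zero => exact ⟨measurable_const, measurable_const, measurable_const, measurable_const⟩
  | succ k ih =>
    obtain ⟨hx, hx', hz, hz'⟩ := ih fun j t h1 h2 h3 => h j t h1 (by lia) h3
    have hinner := measurable_proxSlide (R := I.R) (β := I.beta (k + 1))
      (sfo := fun ω => sfo ω (k + 1))
      (g := fun ω => (1 / I.lam) •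
        (midY' (run I PO (sfo ω) k) (k + 1) - midY (run I PO (sfo ω) k) (k + 1)))
      (u₀ := fun ω => (run I PO (sfo ω) k).z') (by unfold midY midY'; fun_prop) hz' (I.T (k + 1))
      (fun t ht => h (k + 1) t (by lia) le_rfl ht)
    have hzn : Measurable (fun ω => (run I PO (sfo ω) (k + 1)).z) :=
      hPO.comp (by unfold midY midY'; fun_prop)
    have havg : Measurable fun ω => (innerRun I (sfo ω (k + 1)) (run I PO (sfo ω) k) (k + 1)
      (I.T (k + 1))).avg := hinner.2
    exact ⟨(hx.const_smul (1 - gam (k + 1))).add (hzn.const_smul (gam (k + 1))),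
      (hx'.const_smul (1 - gam (k + 1))).add (havg.const_smul (gam (k + 1))), hzn, hinner.1⟩

/-- The expected error of one inner iteration, for a query point `u` that is measurable with
respect to `m`: the linear part of the error vanishes, as the answer deviates from its conditional
mean by a conditionally centred vector. -/
theorem integral_err_le {d : ℕ} {Ω : Type*} {m m₀ : MeasurableSpace Ω} (hle : m ≤ m₀)
    {P : Measure Ω} [IsProbabilityMeasure P] {G σ R β : ℝ} (hβ : 0 < β) {u ghat : Ω → Vec d}
    (hum : Measurable[m] u) (hghat : Integrable ghat P)
    (hsq : Integrable (fun ω => ‖ghat ω - (P[ghat | m]) ω‖ ^ 2) P)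
    (hvar : ∀ᵐ ω ∂P, (P[fun ω' => ‖ghat ω' - (P[ghat | m]) ω'‖ ^ 2 | m]) ω ≤ σ ^ 2)
    (hu : ∀ ω, u ω ∈ Metric.closedBall 0 R) (y : Vec d) (t : ℕ) :
    Integrable (fun ω => err G β t (ghat ω - (P[ghat | m]) ω) (u ω - y)) P ∧
    ∫ ω, err G β t (ghat ω - (P[ghat | m]) ω) (u ω - y) ∂P ≤
      (8 * G ^ 2 + 2 * σ ^ 2) / (β * (t + 1)) := by
  have hδ : Integrable (ghat - P[ghat | m]) P := hghat.sub integrable_condExp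
  have huy : StronglyMeasurable[m] fun ω => u ω - y :=
    hum.stronglyMeasurable.sub (stronglyMeasurable_const (b := y))
  have hint : Integrable (fun ω => innerSL ℝ ((ghat - P[ghat | m]) ω) (u ω - y)) P := by
    refine (hδ.norm.const_mul (R + ‖y‖)).mono'
      (hδ.aestronglyMeasurable.inner (huy.mono hle).aestronglyMeasurable)
      (Filter.Eventually.of_forall fun ω => ?_)
    have h1 : ‖u ω - y‖ ≤ R + ‖y‖ :=
      (norm_sub_le _ _).trans (by gcongr; exact mem_closedBall_zero_iff.1 (hu ω))
    rw [innerSL_apply_apply, mul_comm]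
    exact (norm_inner_le_norm _ _).trans (by gcongr)
  have hint' : Integrable (fun ω => inner ℝ (ghat ω - (P[ghat | m]) ω) (u ω - y)) P := hint
  have hzero : ∫ ω, inner ℝ (ghat ω - (P[ghat | m]) ω) (u ω - y) ∂P = 0 := by
    have h1 := condExp_bilin_of_stronglyMeasurable_right (innerSL ℝ) huy hint hδ
    have h2 : P[ghat - P[ghat | m] | m] =ᵐ[P] 0 := by
      refine (condExp_sub hghat integrable_condExp m).trans ?_
      rw [condExp_of_stronglyMeasurable hle stronglyMeasurable_condExp integrable_condExp, sub_self]
    calc _ = ∫ ω, (P[fun ω => innerSL ℝ ((ghat - P[ghat | m]) ω) (u ω - y) | m]) ω ∂P :=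
          (integral_condExp hle).symm
      _ = ∫ ω, (0 : ℝ) ∂P := by
          refine integral_congr_ae ?_
          filter_upwards [h1, h2] with ω hω1 hω2
          rw [hω1, hω2]; simp
      _ = 0 := integral_zero ..
  have hsqint : ∫ ω, ‖ghat ω - (P[ghat | m]) ω‖ ^ 2 ∂P ≤ σ ^ 2 := by
    rw [← integral_condExp hle]
    refine (integral_mono_ae integrable_condExp (integrable_const (σ ^ 2)) hvar).trans_eq ?_
    simp
  have hq : Integrable (fun ω => (8 * G ^ 2 + 2 * ‖ghat ω - (P[ghat | m]) ω‖ ^ 2) /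
      (β * (t + 1))) P :=
    ((integrable_const _).add (hsq.const_mul 2)).div_const _
  refine ⟨hq.sub hint', ?_⟩
  unfold err
  rw [integral_sub hq hint', hzero, sub_zero, integral_div,
    integral_add (integrable_const _) (hsq.const_mul 2), integral_const_mul (2 : ℝ)]
  simp only [integral_const, probReal_univ, one_smul]
  gcongr

/-- The choice of `T_k` makes all outer steps contribute equally to the expected error. -/
theorem integral_innerErr_le {d : ℕ} {Ω : Type*} [MeasurableSpace Ω] {P : Measure Ω}
    [IsProbabilityMeasure P] {I : Input d} {f : Vec d → ℝ} {PO : Vec d → Vec d}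
    {sfo : Ω → ℕ → ℕ → Vec d → Vec d} (hlam : 0 < I.lam) (hG : 0 < I.G) (hR : 0 ≤ I.R)
    (hDt : 0 < I.Dt) (hK : 0 < I.K) (hx₀ : I.x₀ ∈ Metric.closedBall 0 I.R) (y : Vec d) (k : ℕ)
    (h : ∀ t < I.T (k + 1), IsSFOAnswer P f (Metric.closedBall 0 I.R) I.G I.σ
      (fun ω => query I PO (sfo ω) (k + 1) t)
      (fun ω => sfo ω (k + 1) t (query I PO (sfo ω) (k + 1) t))) :
    Integrable (fun ω => innerErr I (sfo ω (k + 1))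
      (fun t => (P[fun ω => sfo ω (k + 1) t (query I PO (sfo ω) (k + 1) t) |
        MeasurableSpace.comap (fun ω => query I PO (sfo ω) (k + 1) t) inferInstance]) ω)
      (run I PO (sfo ω) k) (k + 1) y) P ∧
    ((k : ℝ) + 1) * ∫ ω, innerErr I (sfo ω (k + 1))
      (fun t => (P[fun ω => sfo ω (k + 1) t (query I PO (sfo ω) (k + 1) t) |
        MeasurableSpace.comap (fun ω => query I PO (sfo ω) (k + 1) t) inferInstance]) ω)
      (run I PO (sfo ω) k) (k + 1) y ∂P ≤ 4 * I.Dt / (I.lam * I.K) := by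
  have hβ : 0 < I.beta (k + 1) := by unfold Input.beta; positivity
  have herr := fun t ht => integral_err_le (G := I.G) (R := I.R)
    (h t ht).measurable_query.comap_le hβ (comap_measurable _) (h t ht).integrable_answer
    (h t ht).integrable_sq (h t ht).variance_le
    (fun ω => (proxSlide_mem hR _ _ (run_mem_ball hR hx₀ PO (sfo ω) k).2 _ _).1) y t
  have hint : ∀ t ∈ Finset.range (I.T (k + 1)), Integrable (fun ω => ((t : ℝ) + 2) *
      err I.G (I.beta (k + 1)) t (sfo ω (k + 1) t (query I PO (sfo ω) (k + 1) t) -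
        (P[fun ω => sfo ω (k + 1) t (query I PO (sfo ω) (k + 1) t) |
        MeasurableSpace.comap (fun ω => query I PO (sfo ω) (k + 1) t) inferInstance]) ω)
        (query I PO (sfo ω) (k + 1) t - y)) P :=
    fun t ht => (herr t (Finset.mem_range.1 ht)).1.const_mul _
  refine ⟨(integrable_finsetSum _ hint).const_mul _, ?_⟩
  have hT : (0 : ℝ) < I.T (k + 1) := by
    exact_mod_cast I.T_pos hlam hG hDt hK (show 1 ≤ k + 1 by lia)
  have hsum : ∑ t ∈ Finset.range (I.T (k + 1)), ∫ ω, ((t : ℝ) + 2) *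
      err I.G (I.beta (k + 1)) t (sfo ω (k + 1) t (query I PO (sfo ω) (k + 1) t) -
        (P[fun ω => sfo ω (k + 1) t (query I PO (sfo ω) (k + 1) t) |
        MeasurableSpace.comap (fun ω => query I PO (sfo ω) (k + 1) t) inferInstance]) ω)
        (query I PO (sfo ω) (k + 1) t - y) ∂P ≤
      I.T (k + 1) * (2 * ((8 * I.G ^ 2 + 2 * I.σ ^ 2) / I.beta (k + 1))) := by
    rw [← nsmul_eq_mul]
    refine (Finset.sum_le_card_nsmul _ _ _ fun t ht => ?_).trans_eq (by rw [Finset.card_range])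
    rw [integral_const_mul]
    have h1 := mul_le_mul_of_nonneg_left (herr t (Finset.mem_range.1 ht)).2
      (show (0 : ℝ) ≤ (t : ℝ) + 2 by positivity)
    refine h1.trans ?_
    rw [← div_div, mul_div_assoc', div_le_iff₀ (by positivity)]
    have : 0 ≤ (8 * I.G ^ 2 + 2 * I.σ ^ 2) / I.beta (k + 1) := by positivity
    nlinarith [mul_nonneg this (t.cast_nonneg (α := ℝ))]
  have hTle : (4 * I.G ^ 2 + I.σ ^ 2) * I.lam ^ 2 * I.K * ((k : ℝ) + 1) ^ 2 / (2 * I.Dt) ≤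
      I.T (k + 1) := by
    have := Nat.le_ceil ((4 * I.G ^ 2 + I.σ ^ 2) * I.lam ^ 2 * I.K * (((k + 1 : ℕ) : ℝ)) ^ 2 /
      (2 * I.Dt))
    push_cast at this
    unfold Input.T
    push_cast
    exact this
  have hK' : (0 : ℝ) < I.K := by exact_mod_cast hK
  unfold innerErr
  rw [integral_const_mul]
  refine (mul_le_mul_of_nonneg_left (mul_le_mul_of_nonneg_left
    ((integral_finsetSum _ hint).trans_le hsum) (slack_nonneg _)) (by positivity)).trans ?_
  have hβ' : ((k : ℝ) + 1) / I.beta (k + 1) = I.lam * (k + 1) ^ 2 / 4 := by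
    unfold Input.beta; push_cast; field_simp
  calc _ = 8 * (4 * I.G ^ 2 + I.σ ^ 2) * (((k : ℝ) + 1) / I.beta (k + 1)) / (I.T (k + 1) + 3) := by
        unfold slack; field_simp; ring
    _ ≤ 8 * (4 * I.G ^ 2 + I.σ ^ 2) * (((k : ℝ) + 1) / I.beta (k + 1)) / I.T (k + 1) := by
        gcongr; linarith
    _ ≤ _ := by
        rw [hβ', div_le_div_iff₀ hT (by positivity)]
        rw [div_le_iff₀ (by positivity)] at hTle
        linarith

/-- The guarantee for general parameters. -/
theorem integral_output_sub_le {d : ℕ} {Ω : Type*} [MeasurableSpace Ω] {P : Measure Ω}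
    [IsProbabilityMeasure P] {I : Input d} {f : Vec d → ℝ} {X : Set (Vec d)}
    {PO : Vec d → Vec d} {sfo : Ω → ℕ → ℕ → Vec d → Vec d} (hlam : 0 < I.lam) (hG : 0 < I.G)
    (hR : 0 ≤ I.R) (hDt : 0 < I.Dt) (hK : 0 < I.K)
    (hconv : ConvexOn ℝ (Metric.closedBall 0 I.R) f)
    (hlip : LipschitzOnWith I.G.toNNReal f (Metric.closedBall 0 I.R))
    (hX : Convex ℝ X) (hXR : X ⊆ Metric.closedBall 0 I.R) (hPO : IsProjectionOracle X PO)
    (hx₀ : I.x₀ ∈ Metric.closedBall 0 I.R) {y : Vec d} (hy : y ∈ X)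
    (h : ∀ k t, 1 ≤ k → k ≤ I.K → t < I.T k → IsSFOAnswer P f (Metric.closedBall 0 I.R) I.G I.σ
      (fun ω => query I PO (sfo ω) k t) (fun ω => sfo ω k t (query I PO (sfo ω) k t))) :
    Integrable (fun ω => f (output I PO (sfo ω)).x) P ∧
    (I.K : ℝ) * (I.K + 1) / 2 *
        ((∫ ω, f (output I PO (sfo ω)).x ∂P) - f y - I.G ^ 2 * I.lam / 2) ≤
      5 / I.lam * ‖I.x₀ - y‖ ^ 2 + 4 * I.Dt / I.lam := by
  have hK' : (0 : ℝ) < I.K := by exact_mod_cast hK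
  have hxX : ∀ ω, (output I PO (sfo ω)).x ∈ X := fun ω => by
    have := run_x_mem (I := I) hX hPO (sfo ω) (I.K - 1)
    rwa [Nat.sub_add_cancel hK] at this
  have hmeas := (measurable_run (hPO.measurable hX) I.K
    (fun j t h1 h2 h3 => (h j t h1 h2 h3).measurable_answer)).1
  have hfmeas : Measurable fun ω => f (output I PO (sfo ω)).x :=
    (continuousOn_iff_continuous_domRestrict.1 hlip.continuousOn).measurable.comp
      (hmeas.subtype_mk (h := fun ω => hXR (hxX ω)))
  have hfint : Integrable (fun ω => f (output I PO (sfo ω)).x) P := by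
    refine Integrable.of_bound hfmeas.aestronglyMeasurable (|f y| + I.G * (2 * I.R))
      (Filter.Eventually.of_forall fun ω => ?_)
    have h1 := hlip.dist_le_mul _ (hXR (hxX ω)) y (hXR hy)
    have h2 : dist (output I PO (sfo ω)).x y ≤ 2 * I.R :=
      (dist_le_norm_add_norm _ _).trans (by
        linarith [mem_closedBall_zero_iff.1 (hXR (hxX ω)), mem_closedBall_zero_iff.1 (hXR hy)])
    rw [Real.coe_toNNReal _ hG.le, Real.dist_eq] at h1
    have h3 := mul_le_mul_of_nonneg_left h2 hG.le
    rw [Real.norm_eq_abs]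
    linarith [abs_sub_abs_le_abs_sub (f (output I PO (sfo ω)).x) (f y)]
  refine ⟨hfint, ?_⟩
  obtain ⟨s, hs⟩ : ∃ s : Ω → ℕ → ℕ → Vec d, s = fun ω k t =>
    (P[fun ω => sfo ω k t (query I PO (sfo ω) k t) |
      MeasurableSpace.comap (fun ω => query I PO (sfo ω) k t) inferInstance]) ω := ⟨_, rfl⟩
  have herr : ∀ j ∈ Finset.range I.K, Integrable (fun ω => innerErr I (sfo ω (j + 1))
      (s ω (j + 1)) (run I PO (sfo ω) j) (j + 1) y) P ∧ ((j : ℝ) + 1) *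
      ∫ ω, innerErr I (sfo ω (j + 1)) (s ω (j + 1)) (run I PO (sfo ω) j) (j + 1) y ∂P ≤
      4 * I.Dt / (I.lam * I.K) := fun j hj => by
    rw [hs]
    exact integral_innerErr_le hlam hG hR hDt hK hx₀ y j
      fun t ht => h (j + 1) t (by lia) (Finset.mem_range.1 hj) ht
  have hae : ∀ᵐ ω ∂P, ∀ k t, 1 ≤ k → k ≤ I.K → t < I.T k →
      s ω k t ∈ subdiff f (Metric.closedBall 0 I.R) (query I PO (sfo ω) k t) ∧
      ‖s ω k t‖ ≤ I.G := by
    simp only [ae_all_iff]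
    intro k t h1 h2 h3
    rw [hs]
    filter_upwards [(h k t h1 h2 h3).mean_mem, (h k t h1 h2 h3).mean_norm_le] with ω hω1 hω2
    exact ⟨hω1, hω2⟩
  have hpath : ∀ᵐ ω ∂P, (I.K : ℝ) * (I.K + 1) / 2 *
      (f (output I PO (sfo ω)).x - f y - I.G ^ 2 * I.lam / 2) ≤
      5 / I.lam * ‖I.x₀ - y‖ ^ 2 + ∑ j ∈ Finset.range I.K, ((j : ℝ) + 1) *
        innerErr I (sfo ω (j + 1)) (s ω (j + 1)) (run I PO (sfo ω) j) (j + 1) y := by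
    filter_upwards [hae] with ω hω
    have h1 := run_bound hlam hG hR hDt hK hconv hlip hX hPO hx₀ (sfo ω) hy (hXR hy) (s ω) I.K
      (fun j t h1 h2 h3 => (hω j t h1 h2 h3).1) (fun j t h1 h2 h3 => (hω j t h1 h2 h3).2)
    have h2 := sub_le_gap_add hG.le hlam hlip (hXR (hxX ω))
      (run_mem_ball hR hx₀ PO (sfo ω) I.K).1 y
    have h3 := mul_le_mul_of_nonneg_left (sub_le_iff_le_add.2 h2)
      (show (0 : ℝ) ≤ (I.K : ℝ) * (I.K + 1) / 2 by positivity)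
    have h4 : 0 ≤ 2 / I.lam * ‖(run I PO (sfo ω) I.K).z - y‖ ^ 2 := by positivity
    have h5 : 0 ≤ 2 / I.lam * (1 + slack (I.T (I.K + 1))) *
        ‖(run I PO (sfo ω) I.K).z' - y‖ ^ 2 := by
      have := slack_nonneg (I.T (I.K + 1))
      positivity
    unfold output at h3 ⊢
    linarith
  have hsumint := integrable_finsetSum (Finset.range I.K)
    (fun j hj => (herr j hj).1.const_mul ((j : ℝ) + 1))
  have hfy : Integrable (fun ω => f (output I PO (sfo ω)).x - f y) P :=
    hfint.sub (integrable_const (f y))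
  have hfi := hfy.sub (integrable_const (I.G ^ 2 * I.lam / 2))
  have hmono := integral_mono_ae (hfi.const_mul ((I.K : ℝ) * (I.K + 1) / 2))
    ((integrable_const (5 / I.lam * ‖I.x₀ - y‖ ^ 2)).add hsumint) hpath
  have hleft : ∫ ω, (f (output I PO (sfo ω)).x - f y - I.G ^ 2 * I.lam / 2) ∂P =
      (∫ ω, f (output I PO (sfo ω)).x ∂P) - f y - I.G ^ 2 * I.lam / 2 := by
    rw [integral_sub hfy (integrable_const _),
      integral_sub hfint (integrable_const _)]
    simp
  have hright : ∫ ω, (5 / I.lam * ‖I.x₀ - y‖ ^ 2 + ∑ j ∈ Finset.range I.K, ((j : ℝ) + 1) *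
      innerErr I (sfo ω (j + 1)) (s ω (j + 1)) (run I PO (sfo ω) j) (j + 1) y) ∂P ≤
      5 / I.lam * ‖I.x₀ - y‖ ^ 2 + 4 * I.Dt / I.lam := by
    rw [integral_add (integrable_const _) hsumint,
      integral_finsetSum _ fun j hj => (herr j hj).1.const_mul _]
    simp only [integral_const, probReal_univ, one_smul, integral_const_mul]
    gcongr
    refine (Finset.sum_le_card_nsmul _ _ _ fun j hj => (herr j hj).2).trans_eq ?_
    rw [Finset.card_range, nsmul_eq_mul]
    field_simp
  rw [← hleft, ← integral_const_mul]
  exact le_trans hmono hright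

/-! ### The prescribed parameters -/

/-- The total number of inner iterations. -/
theorem sum_T_le {d : ℕ} (I : Input d) (hDt : 0 ≤ I.Dt) :
    ((∑ j ∈ Finset.range I.K, I.T (j + 1) : ℕ) : ℝ) ≤
      (4 * I.G ^ 2 + I.σ ^ 2) * I.lam ^ 2 * I.K ^ 4 / (2 * I.Dt) + I.K := by
  have h (j : ℕ) (hj : j ∈ Finset.range I.K) : (I.T (j + 1) : ℝ) ≤
      (4 * I.G ^ 2 + I.σ ^ 2) * I.lam ^ 2 * I.K ^ 3 / (2 * I.Dt) + 1 := by
    have hjK : ((j + 1 : ℕ) : ℝ) ≤ I.K := by exact_mod_cast Finset.mem_range.1 hj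
    refine (Nat.ceil_lt_add_one (by positivity)).le.trans ?_
    have : (4 * I.G ^ 2 + I.σ ^ 2) * I.lam ^ 2 * I.K * ((j + 1 : ℕ) : ℝ) ^ 2 / (2 * I.Dt) ≤
        (4 * I.G ^ 2 + I.σ ^ 2) * I.lam ^ 2 * I.K * (I.K : ℝ) ^ 2 / (2 * I.Dt) := by gcongr
    refine (add_le_add_left this 1).trans_eq ?_
    ring
  rw [Nat.cast_sum]
  refine (Finset.sum_le_card_nsmul _ _ _ h).trans_eq ?_
  rw [Finset.card_range, nsmul_eq_mul]
  ring

/-- With `a` for `G * ‖x₀ - xs‖ / ε`, the number `K` is linear in `a` once `a` is bounded below. -/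
theorem ceil_le_mul {b r a : ℝ} (hb : 0 ≤ b) (hr : 0 < r) (ha : r ≤ a) :
    (⌈b * a⌉₊ : ℝ) ≤ (b + 1 / r) * a := by
  have ha0 : 0 < a := hr.trans_le ha
  have h1 : 1 ≤ 1 / r * a := by rw [one_div_mul_eq_div]; exact (one_le_div hr).2 ha
  linarith [(Nat.ceil_lt_add_one (mul_nonneg hb ha0.le)).le]

end Mopes

theorem mainTheorem1 (c r : ℝ) (hc : 0 < c) (hr : 0 < r) :
    ∃ C : ℝ, 0 < C ∧
      ∀ (d : ℕ) (G σ R ε : ℝ) (X : Set (Mopes.Vec d)) (f : Mopes.Vec d → ℝ)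
        (PO : Mopes.Vec d → Mopes.Vec d) (x₀ xs : Mopes.Vec d) (I : Mopes.Input d)
        (Ω : Type*) [MeasurableSpace Ω] (P : Measure Ω) [IsProbabilityMeasure P]
        (sfo : Ω → ℕ → ℕ → Mopes.Vec d → Mopes.Vec d),
        0 < G → 0 < ε →
        ConvexOn ℝ (Metric.closedBall 0 R) f →
        LipschitzOnWith G.toNNReal f (Metric.closedBall 0 R) →
        Convex ℝ X → X ⊆ Metric.closedBall 0 R →
        Mopes.IsProjectionOracle X PO →
        x₀ ∈ Metric.closedBall 0 R →
        xs ∈ X → IsMinOn f X xs →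
        I = Mopes.prescribedInput c G σ R ε x₀ xs →
        (∀ k t : ℕ, 1 ≤ k → k ≤ I.K → t < I.T k →
          Mopes.IsSFOAnswer P f (Metric.closedBall 0 R) G σ
            (fun ω => Mopes.query I PO (sfo ω) k t)
            (fun ω => sfo ω k t (Mopes.query I PO (sfo ω) k t))) →
        (∀ ω, (Mopes.output I PO (sfo ω)).x ∈ X) ∧
        Integrable (fun ω => f (Mopes.output I PO (sfo ω)).x) P ∧
        (∫ ω, f (Mopes.output I PO (sfo ω)).x ∂P) - f xs ≤ ε ∧
        (r * ε ≤ G * ‖x₀ - xs‖ → ∀ ω,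
          ((Mopes.output I PO (sfo ω)).poCalls : ℝ) ≤ C * (G * ‖x₀ - xs‖ / ε) ∧
          ((Mopes.output I PO (sfo ω)).foCalls : ℝ) ≤
            C * ((G ^ 2 + σ ^ 2) * ‖x₀ - xs‖ ^ 2 / ε ^ 2)) := by
  have hb0 : 0 ≤ 2 * Real.sqrt (10 + 8 * c) := by positivity
  have hκ : 0 < 2 * Real.sqrt (10 + 8 * c) + 1 / r := by positivity
  obtain ⟨b, hb⟩ : ∃ b, b = 2 * Real.sqrt (10 + 8 * c) := ⟨_, rfl⟩
  obtain ⟨κ, hκb⟩ : ∃ κ, κ = b + 1 / r := ⟨_, rfl⟩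
  rw [← hb] at hb0
  rw [← hb, ← hκb] at hκ
  refine ⟨κ + 2 * κ ^ 4 / c + κ / r, by positivity, ?_⟩
  intro d G σ R ε X f PO x₀ xs I Ω _ P _ sfo hG hε hconv hlip hX hXR hPO hx₀ hxs _ hI hsfo
  have hR : 0 ≤ R := (norm_nonneg _).trans (mem_closedBall_zero_iff.1 hx₀)
  have hKeq : I.K = ⌈b * (G * ‖x₀ - xs‖ / ε)⌉₊ := by
    rw [hI, hb]
    simp only [Mopes.prescribedInput]
    congr 1
    ring
  rcases eq_or_ne x₀ xs with h0 | h0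
  · -- no step is made: `K = 0`
    have hK0 : I.K = 0 := by rw [hKeq, h0]; simp
    have hout (ω : Ω) : (Mopes.output I PO (sfo ω)).x = xs := by
      rw [Mopes.output, hK0, ← h0, hI]; rfl
    simp only [hout]
    refine ⟨fun _ => hxs, integrable_const _, by simp [hε.le], fun h => ?_⟩
    rw [h0, sub_self, norm_zero, mul_zero] at h
    exact absurd (mul_pos hr hε) (not_lt.2 h)
  have hD : 0 < ‖x₀ - xs‖ := norm_pos_iff.2 (sub_ne_zero.2 h0)
  have ha : 0 < G * ‖x₀ - xs‖ / ε := by positivity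
  have hbpos : 0 < b := by rw [hb]; positivity
  have hKpos : 0 < I.K := by rw [hKeq, Nat.ceil_pos]; positivity
  have hIG : I.G = G := by rw [hI]; rfl
  have hIσ : I.σ = σ := by rw [hI]; rfl
  have hIR : I.R = R := by rw [hI]; rfl
  have hIx : I.x₀ = x₀ := by rw [hI]; rfl
  have hIlam : I.lam = ε / G ^ 2 := by rw [hI]; rfl
  have hIDt : I.Dt = c * ‖x₀ - xs‖ ^ 2 := by rw [hI]; rfl
  have hmain := Mopes.integral_output_sub_le (P := P) (I := I) (f := f) (X := X) (PO := PO)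
    (sfo := sfo) (y := xs) (by rw [hIlam]; positivity) (by rwa [hIG]) (by rwa [hIR])
    (by rw [hIDt]; positivity) hKpos (by rwa [hIR]) (by rwa [hIG, hIR]) hX (by rwa [hIR]) hPO
    (by rwa [hIx, hIR]) hxs (by rwa [hIG, hIR, hIσ])
  refine ⟨fun ω => ?_, hmain.1, ?_, fun hrε ω => ?_⟩
  · have := Mopes.run_x_mem (I := I) hX hPO (sfo ω) (I.K - 1)
    rwa [Nat.sub_add_cancel hKpos] at this
  · have h1 := hmain.2
    rw [hIG, hIx, hIlam, hIDt] at h1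
    generalize ∫ ω, f (Mopes.output I PO (sfo ω)).x ∂P = F at h1 ⊢
    have h2 : b * (G * ‖x₀ - xs‖ / ε) ≤ I.K := by rw [hKeq]; exact Nat.le_ceil _
    -- the constant `10 + 8 c` makes the penalized gap at most `ε / 2`; the penalty costs the rest
    have h3 : b ^ 2 = 4 * (10 + 8 * c) := by
      rw [hb, mul_pow, Real.sq_sqrt (by positivity)]; ring
    have h4 : 4 * (10 + 8 * c) * (G * ‖x₀ - xs‖ / ε) ^ 2 ≤ (I.K : ℝ) ^ 2 := by
      rw [← h3, ← mul_pow]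
      exact pow_le_pow_left₀ (by positivity) h2 2
    have h5 : G ^ 2 * (ε / G ^ 2) / 2 = ε / 2 := by field_simp
    have h6 : 5 / (ε / G ^ 2) * ‖x₀ - xs‖ ^ 2 + 4 * (c * ‖x₀ - xs‖ ^ 2) / (ε / G ^ 2) =
        4 * (10 + 8 * c) * (G * ‖x₀ - xs‖ / ε) ^ 2 * (ε / 8) := by
      field_simp; ring
    rw [h5, h6] at h1
    have hK0 : (0 : ℝ) < I.K := by exact_mod_cast hKpos
    have h7 : (I.K : ℝ) * (I.K + 1) / 2 * (F - f xs - ε / 2) ≤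
        (I.K : ℝ) * (I.K + 1) / 2 * (ε / 2) :=
      calc _ ≤ (I.K : ℝ) ^ 2 * (ε / 8) := h1.trans (by gcongr)
        _ ≤ _ := by nlinarith [mul_pos hK0 hε, mul_pos (mul_pos hK0 hK0) hε]
    linarith [le_of_mul_le_mul_left h7 (by positivity)]
  · have hra : r ≤ G * ‖x₀ - xs‖ / ε := (le_div_iff₀ hε).2 hrε
    have hKle : (I.K : ℝ) ≤ κ * (G * ‖x₀ - xs‖ / ε) := by
      rw [hKeq, hκb]; exact Mopes.ceil_le_mul hb0 hr hra
    rw [Mopes.output, Mopes.run_poCalls, Mopes.run_foCalls]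
    constructor
    · refine hKle.trans (mul_le_mul_of_nonneg_right ?_ ha.le)
      have : 0 ≤ 2 * κ ^ 4 / c + κ / r := by positivity
      linarith
    · refine (Mopes.sum_T_le I (by rw [hIDt]; positivity)).trans ?_
      rw [hIG, hIσ, hIlam, hIDt]
      have h1 : (4 * G ^ 2 + σ ^ 2) * (ε / G ^ 2) ^ 2 * (I.K : ℝ) ^ 4 / (2 * (c * ‖x₀ - xs‖ ^ 2)) ≤
          2 * κ ^ 4 / c * ((G ^ 2 + σ ^ 2) * ‖x₀ - xs‖ ^ 2 / ε ^ 2) :=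
        calc _ ≤ (4 * (G ^ 2 + σ ^ 2)) * (ε / G ^ 2) ^ 2 * (κ * (G * ‖x₀ - xs‖ / ε)) ^ 4 /
              (2 * (c * ‖x₀ - xs‖ ^ 2)) := by
              gcongr
              linarith [sq_nonneg σ]
          _ = _ := by field_simp; ring
      have h2 : (I.K : ℝ) ≤ κ / r * ((G ^ 2 + σ ^ 2) * ‖x₀ - xs‖ ^ 2 / ε ^ 2) :=
        calc _ ≤ κ * (G * ‖x₀ - xs‖ / ε) := hKle
          _ = κ / r * (r * (G * ‖x₀ - xs‖ / ε)) := by field_simp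
          _ ≤ κ / r * (G * ‖x₀ - xs‖ / ε * (G * ‖x₀ - xs‖ / ε)) := by gcongr
          _ = κ / r * (G ^ 2 * ‖x₀ - xs‖ ^ 2 / ε ^ 2) := by ring
          _ ≤ _ := by
              gcongr
              linarith [sq_nonneg σ]
      have h3 : 0 ≤ κ * ((G ^ 2 + σ ^ 2) * ‖x₀ - xs‖ ^ 2 / ε ^ 2) := by positivity
      rw [add_mul (κ + _), add_mul κ]
      linarith
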